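/- Let $\Gamma$ be the vertex set of a connected graph with path distance $d$. Let each site $i\in\Gamma$ carry a finite-dimensional Hilbert space $\mathcal H_i$. For finite $\Lambda\subset\Gamma$ put $\mathcal H_\Lambda=\bigotimes_{i\in\Lambda}\mathcal H_i$. Let $\Phi$ assign to every finite $Z\subset\Gamma$ a self-adjoint operator $\Phi(Z)$ on $\mathcal H_Z$, and let $H_\Lambda=\sum_{Z\subseteq\Lambda}\Phi(Z)\otimes \mathbb 1_{\Lambda\setminus Z}$. Let $F:[0,\infty)\to(0,\infty)$ be non-increasing with $$\|F\|=\sup_{i}\sum_{j}F(d(i,j))<\infty,\qquad C_\mu=\sup_{i,j}\sum_k \frac{e^{-\mu[d(i,k)+d(k,j)-d(i,j)]}F(d(i,k))F(d(k,j))}{F(d(i,j))}<\infty\quad(\mu\ge 0).$$ Let $$\|\Phi\|_\mu=\sup_{i,j}\sum_{Z\ni i,j}\frac{\|\Phi(Z)\|}{e^{-\mu d(i,j)}F(d(i,j))},\qquad v_\mu=\frac{2\|\Phi\|_\mu C_\mu}{\mu},$$ and let $\partial_\Phi X$ be the set of $i\in X$ for which there is a finite $Z\ni i$ with $Z\cap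 X^c\ne\varnothing$ and $\Phi(Z)\neq0$. Let $\Lambda\subset\Gamma$ be finite, and let $X,Y\subseteq\Lambda$ be nonempty with $d(X,Y)>0$. Let $W$ be a self-adjoint and $U_X$ a unitary operator on $\mathcal H_\Lambda$, both supported on $X$. Let $\psi\in\mathcal H_\Lambda$ be a unit vector. Put $\psi^0(t)=e^{-iH_\Lambda t}\psi$, $\psi^1(t)=e^{-i(H_\Lambda+W)t}\psi$, $\psi^2(t)=e^{-iH_\Lambda t}U_X\psi$, and $\rho^q_Y(t)=\mathrm{Tr}_{\Lambda\setminus Y}|\psi^q(t)\rangle\langle\psi^q(t)|$ for $q=0,1,2$. Then for every $\mu>0$ with $\|\Phi\|_\mu<\infty$, every $t\in\mathbb R$ and $q=1,2$, $$\|\rho^0_Y(t)-\rho^q_Y(t)\|_1\le c_q\,e^{-\mu(d(X,Y)-v_\mu|t|)},$$ where $\|A\|_1=\sup_{\|U\|=1}|\mathrm{Tr}(AU)|$ and $$c_1=\frac{2\|W\|\,\|F\|}{\mu v_\mu C_\mu}\min\{|\partial_\Phi X|,|\partial_\Phi Y|\},\qquad c_2=\frac{2\|F\|}{C_\mu}\min\{|\partial_\Phi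 X|,|\partial_\Phi Y|\};$$ if $v_\mu=0$ (in which case $\partial_\Phi X=\partial_\Phi Y=\varnothing$), $c_1$ is read as $0$. -/

import Mathlib

open scoped Matrix.Norms.L2Operator

namespace SpinLattice

noncomputable section

/-! Lattice geometry. The lattice `Γ` is the vertex set of a graph `G` with its path distance. -/

/-- The distance `d(X,Y) = min {d(i,j) : i ∈ X, j ∈ Y}` between two (nonempty) finite sets. -/
def setDist {Γ : Type*} (G : SimpleGraph Γ) (X Y : Finset Γ) : ℕ :=
  sInf {n : ℕ | ∃ i ∈ X, ∃ j ∈ Y, G.dist i j = n}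

/-- `‖F‖ = sup_i ∑_j F(d(i,j))`, as an extended nonnegative real. -/
def decayNorm {Γ : Type*} (G : SimpleGraph Γ) (F : ℝ → ℝ) : ENNReal :=
  ⨆ i : Γ, ∑' j : Γ, ENNReal.ofReal (F (G.dist i j))

/-- `C_μ = sup_{i,j} ∑_k e^{-μ[d(i,k)+d(k,j)-d(i,j)]} F(d(i,k)) F(d(k,j)) / F(d(i,j))`, as an
extended nonnegative real. -/
def convConst {Γ : Type*} (G : SimpleGraph Γ) (F : ℝ → ℝ) (μ : ℝ) : ENNReal :=
  ⨆ i : Γ, ⨆ j : Γ, ∑' k : Γ, ENNReal.ofReal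
    (Real.exp (-μ * ((G.dist i k : ℝ) + G.dist k j - G.dist i j))
      * F (G.dist i k) * F (G.dist k j) / F (G.dist i j))

/-- `F : [0,∞) → (0,∞)` is non-increasing, with `‖F‖ < ∞` and `C_μ < ∞` for every `μ ≥ 0`.
Only the values of `F` on `[0,∞)` matter. -/
structure IsDecayFunction {Γ : Type*} (G : SimpleGraph Γ) (F : ℝ → ℝ) : Prop where
  antitoneOn : AntitoneOn F (Set.Ici 0)
  pos : ∀ r : ℝ, 0 ≤ r → 0 < F r
  norm_lt_top : decayNorm G F < ⊤
  conv_lt_top : ∀ μ : ℝ, 0 ≤ μ → convConst G F μ < ⊤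

/-! Spin systems. The site `i` carries the finite-dimensional Hilbert space `ℂ^{S i}`, with
orthonormal basis indexed by the finite type `S i`. For a finite region `Λ` the tensor product
`⨂_{i ∈ Λ} ℂ^{S i}` is `ℂ^{Cfg S Λ}`, its product basis being indexed by the configurations
on `Λ`; operators are matrices in this basis, with the operator norm. -/

/-- Configurations on the region `Λ`: labels of the product basis of `H_Λ`. -/
abbrev Cfg {Γ : Type*} (S : Γ → Type*) (Λ : Finset Γ) := (i : Λ) → S i

/-- The Hilbert space `H_Λ = ⨂_{i ∈ Λ} ℂ^{S i}`. -/
abbrev Hilb {Γ : Type*} (S : Γ → Type*) (Λ : Finset Γ) := EuclideanSpace ℂ (Cfg S Λ)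

/-- Operators on `H_Λ`. -/
abbrev Op {Γ : Type*} (S : Γ → Type*) (Λ : Finset Γ) := Matrix (Cfg S Λ) (Cfg S Λ) ℂ

variable {Γ : Type*} [DecidableEq Γ] {S : Γ → Type*} [∀ i, Fintype (S i)] [∀ i, DecidableEq (S i)]

/-- For `X ⊆ Λ`, the operator `A ⊗ 1_{Λ \ X}` on `H_Λ`. -/
def embed {X Λ : Finset Γ} (h : X ⊆ Λ) (A : Op S X) : Op S Λ :=
  Matrix.of fun σ τ =>
    if ∀ i : Λ, (i : Γ) ∉ X → σ i = τ i then
      A (fun i => σ ⟨i, h i.2⟩) (fun i => τ ⟨i, h i.2⟩)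
    else 0

/-- The operator `A` on `H_Λ` has support on `X ⊆ Λ`: it is of the form `A' ⊗ 1_{Λ \ X}`. -/
def SupportedOn {X Λ : Finset Γ} (h : X ⊆ Λ) (A : Op S Λ) : Prop :=
  ∃ A' : Op S X, A = embed h A'

/-- The configuration on `Λ` that is `α` on `Y` and `γ` on `Λ \ Y`. -/
def glue {Y Λ : Finset Γ} (α : Cfg S Y) (γ : Cfg S (Λ \ Y)) : Cfg S Λ := fun i =>
  if hi : (i : Γ) ∈ Y then α ⟨i, hi⟩ else γ ⟨i, Finset.mem_sdiff.2 ⟨i.2, hi⟩⟩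

/-- The partial trace `Tr_{Λ \ Y}`, from operators on `H_Λ` to operators on `H_Y`. -/
def partialTrace {Λ : Finset Γ} (Y : Finset Γ) (M : Op S Λ) : Op S Y :=
  Matrix.of fun α β => ∑ γ : Cfg S (Λ \ Y), M (glue α γ) (glue β γ)

/-- The trace norm `‖A‖₁ = sup {|Tr (A U)| : ‖U‖ = 1}`, with `‖U‖` the operator norm. -/
def traceNorm {n : Type*} [Fintype n] [DecidableEq n] (A : Matrix n n ℂ) : ℝ :=
  ⨆ U : {U : Matrix n n ℂ // ‖U‖ = 1}, ‖(A * (U : Matrix n n ℂ)).trace‖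

/-- The Hamiltonian `H_Λ = ∑_{Z ⊆ Λ} Φ(Z) ⊗ 1_{Λ \ Z}`. -/
def hamiltonian (Φ : (Z : Finset Γ) → Op S Z) (Λ : Finset Γ) : Op S Λ :=
  ∑ Z ∈ Λ.powerset.attach, embed (Finset.mem_powerset.1 Z.2) (Φ Z)

/-- `‖Φ‖_μ = sup_{i,j} ∑_{Z ∋ i,j} ‖Φ(Z)‖ / (e^{-μ d(i,j)} F(d(i,j)))`, as an extended
nonnegative real. -/
def interactionNorm (G : SimpleGraph Γ) (F : ℝ → ℝ) (Φ : (Z : Finset Γ) → Op S Z) (μ : ℝ) :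
    ENNReal :=
  ⨆ i : Γ, ⨆ j : Γ, ∑' Z : {Z : Finset Γ // i ∈ Z ∧ j ∈ Z},
    ENNReal.ofReal (‖Φ Z‖ / (Real.exp (-μ * (G.dist i j : ℝ)) * F (G.dist i j)))

/-- The velocity `v_μ = 2 ‖Φ‖_μ C_μ / μ`. -/
def velocity (G : SimpleGraph Γ) (F : ℝ → ℝ) (Φ : (Z : Finset Γ) → Op S Z) (μ : ℝ) : ℝ :=
  2 * (interactionNorm G F Φ μ).toReal * (convConst G F μ).toReal / μ

open Classical in
/-- The `Φ`-boundary of `X`: the sites `i ∈ X` that lie in some finite `Z` with `Z ∩ Xᶜ ≠ ∅` and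
`Φ(Z) ≠ 0`. -/
def phiBoundary (Φ : (Z : Finset Γ) → Op S Z) (X : Finset Γ) : Finset Γ :=
  X.filter fun i => ∃ Z : Finset Γ, (∃ k ∈ Z, k ∉ X) ∧ i ∈ Z ∧ Φ Z ≠ 0

/-- The evolved vector `e^{-iHt} ψ`. -/
def evolve {Λ : Finset Γ} (H : Op S Λ) (t : ℝ) (ψ : Hilb S Λ) : Hilb S Λ :=
  Matrix.toEuclideanLin (NormedSpace.exp ((-(Complex.I * (t : ℂ))) • H)) ψ

/-- The reduced state `Tr_{Λ \ Y} |ψ⟩⟨ψ|` on the region `Y`. -/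
def reducedState {Λ : Finset Γ} (Y : Finset Γ) (ψ : Hilb S Λ) : Op S Y :=
  partialTrace Y (Matrix.of fun σ τ => ψ σ * star (ψ τ) : Op S Λ)

end

end SpinLattice

open SpinLattice

/-! Partial trace is dual to `A ↦ A ⊗ 1`, so testing the difference of reduced states against `B` on
`Y` gives an expectation in `ψ` of a difference of Heisenberg observables. Write `τ_t` for the
evolution under `H_Λ`. For the quench of the state this difference is `τ_t(B) - U* τ_t(B) U = U* [U,
τ_t(B)]`. For the quench of the Hamiltonian, Duhamel's formula bounds it by the time integral of
`‖[W, τ_s(B)]‖`. Both cases reduce to a Lieb–Robinson bound on `[A, τ_t(B)]` with `A` on `X`, `B` on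
`Y`.

That bound (`norm_lie_heisenberg_sum_le_add`) works in the interaction picture of the terms inside
`X` or disjoint from `X`. Their flow keeps `A` on `X`, so the commutator grows only through terms
`Z` straddling `X`, at rate at most `2‖A‖ ∑_Z ‖[Φ(Z), τ_s(B)]‖`. Each summand is a commutator of the
same kind. With `κ(x,y) = e^{-μ d(x,y)} F(d(x,y))`, `N = ‖Φ‖_μ` and `C = C_μ`, pair sums of `‖Φ(Z)‖`
are at most `N κ` and `κ * κ ≤ C κ`. Hence the profile `1_{Z ∩ Y ≠ ∅} + (e^{2NCt} - 1)/C · ∑_{x,y}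
κ(x,y)` reproduces itself under iteration, and the n-th remainder is an exponential-series term
tending to `0`. The exponent is `2NC = μ v_μ`.

Straddling terms meet `X` in its `Φ`-boundary, so only boundary points are summed over in the
outermost step. Moving the evolution from `B` to `A` exchanges `X` and `Y` and gives the minimum of
the two boundaries. -/

namespace SpinLattice

/-! ### Heisenberg dynamics in a C*-algebra and comparison of two evolutions -/

section Dynamics

variable {𝔄 : Type*} [CStarAlgebra 𝔄]

/-- The propagator `e^{-iHt}`. -/
noncomputable def propagator (H : 𝔄) (t : ℝ) : 𝔄 :=
  NormedSpace.exp ((-(Complex.I * (t : ℂ))) • H)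

/-- The Heisenberg evolution `e^{iHt} x e^{-iHt}`. -/
noncomputable def heisenberg (H : 𝔄) (t : ℝ) (x : 𝔄) : 𝔄 :=
  propagator H (-t) * x * propagator H t

theorem propagator_zero (H : 𝔄) : propagator H 0 = 1 := by
  simp [propagator]

theorem propagator_neg (H : 𝔄) (t : ℝ) : propagator (-H) t = propagator H (-t) := by
  simp [propagator]

theorem propagator_neg_mul_self (H : 𝔄) (t : ℝ) : propagator H (-t) * propagator H t = 1 := by
  let : NormedAlgebra ℚ 𝔄 := .restrictScalars ℚ ℂ 𝔄
  unfold propagator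
  rw [← NormedSpace.exp_add_of_commute
    (((Commute.refl H).smul_left _).smul_right _), ← add_smul]
  simp

theorem propagator_mul_neg_self (H : 𝔄) (t : ℝ) : propagator H t * propagator H (-t) = 1 := by
  simpa using propagator_neg_mul_self H (-t)

theorem star_propagator {H : 𝔄} (hH : IsSelfAdjoint H) (t : ℝ) :
    star (propagator H t) = propagator H (-t) := by
  let : NormedAlgebra ℚ 𝔄 := .restrictScalars ℚ ℂ 𝔄
  simp [propagator, NormedSpace.star_exp, hH.star_eq]

theorem propagator_mem_unitary {H : 𝔄} (hH : IsSelfAdjoint H) (t : ℝ) :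
    propagator H t ∈ unitary 𝔄 := by
  rw [Unitary.mem_iff, star_propagator hH]
  exact ⟨propagator_neg_mul_self H t, propagator_mul_neg_self H t⟩

theorem commute_propagator {H x : 𝔄} (h : Commute x H) (t : ℝ) : Commute x (propagator H t) :=
  (h.smul_right _).exp_right

theorem hasDerivAt_propagator (H : 𝔄) (t : ℝ) :
    HasDerivAt (propagator H) (propagator H t * (-Complex.I • H)) t := by
  have h : HasDerivAt (fun u : ℝ => NormedSpace.exp (u • (-Complex.I • H)))
      (NormedSpace.exp (t • (-Complex.I • H)) * (-Complex.I • H)) t :=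
    hasDerivAt_exp_smul_const (𝕂 := ℝ) (-Complex.I • H) t
  have e : (fun u : ℝ => NormedSpace.exp (u • (-Complex.I • H))) = propagator H := by
    funext u
    unfold propagator
    rw [← Complex.coe_smul, smul_smul]
    congr 2
    ring
  rwa [e, congrFun e t] at h

theorem hasDerivAt_propagator' (H : 𝔄) (t : ℝ) :
    HasDerivAt (propagator H) ((-Complex.I • H) * propagator H t) t := by
  have := hasDerivAt_propagator H t
  rwa [(commute_propagator ((Commute.refl H).smul_left (-Complex.I)) t).eq]

theorem hasDerivAt_propagator_neg (H : 𝔄) (t : ℝ) :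
    HasDerivAt (fun s => propagator H (-s)) ((Complex.I • H) * propagator H (-t)) t := by
  have := hasDerivAt_propagator' (-H) t
  simpa [propagator_neg, funext (propagator_neg H)] using this

theorem heisenberg_zero (H x : 𝔄) : heisenberg H 0 x = x := by
  simp [heisenberg, propagator_zero]

theorem heisenberg_neg (H : 𝔄) (t : ℝ) (x : 𝔄) : heisenberg (-H) t x = heisenberg H (-t) x := by
  simp [heisenberg, propagator_neg]

theorem heisenberg_mul (H : 𝔄) (t : ℝ) (x y : 𝔄) :
    heisenberg H t (x * y) = heisenberg H t x * heisenberg H t y := by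
  have h := propagator_mul_neg_self H t
  simp only [heisenberg, mul_assoc]
  rw [← mul_assoc (propagator H t) (propagator H (-t)), h, one_mul]

theorem heisenberg_sub (H : 𝔄) (t : ℝ) (x y : 𝔄) :
    heisenberg H t (x - y) = heisenberg H t x - heisenberg H t y := by
  simp [heisenberg, mul_sub, sub_mul]

theorem heisenberg_lie (H : 𝔄) (t : ℝ) (x y : 𝔄) :
    heisenberg H t ⁅x, y⁆ = ⁅heisenberg H t x, heisenberg H t y⁆ := by
  simp only [Ring.lie_def, heisenberg_sub, heisenberg_mul]

theorem heisenberg_neg_heisenberg (H : 𝔄) (t : ℝ) (x : 𝔄) :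
    heisenberg H (-t) (heisenberg H t x) = x := by
  have h := propagator_mul_neg_self H t
  simp only [heisenberg, neg_neg]
  calc _ = (propagator H t * propagator H (-t)) * x * (propagator H t * propagator H (-t)) := by
        noncomm_ring
    _ = x := by rw [h]; simp

theorem norm_heisenberg {H : 𝔄} (hH : IsSelfAdjoint H) (t : ℝ) (x : 𝔄) :
    ‖heisenberg H t x‖ = ‖x‖ := by
  unfold heisenberg
  rw [CStarRing.norm_mul_mem_unitary _ (propagator_mem_unitary hH t),
    CStarRing.norm_mem_unitary_mul _ (propagator_mem_unitary hH (-t))]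

theorem commute_heisenberg {H x y : 𝔄} (hy : Commute y H) (h : Commute x y) (t : ℝ) :
    Commute (heisenberg H t x) y :=
  (((commute_propagator hy (-t)).symm.mul_left h).mul_left (commute_propagator hy t).symm)

/-- The propagator of `H + K` factorises, and the factors of `K` commute past the evolved observable
and cancel. This discards the terms disjoint from the support. -/
theorem heisenberg_add_of_commute {H K x : 𝔄} (h : Commute H K) (hx : Commute x K) (t : ℝ) :
    heisenberg (H + K) t x = heisenberg H t x := by
  let : NormedAlgebra ℚ 𝔄 := .restrictScalars ℚ ℂ 𝔄
  have h1 : ∀ s, propagator (H + K) s = propagator H s * propagator K s := fun s => by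
    unfold propagator
    rw [smul_add, NormedSpace.exp_add_of_commute ((h.smul_left _).smul_right _)]
  have h2 : Commute (heisenberg H t x) (propagator K t) :=
    commute_propagator (commute_heisenberg h.symm hx t) t
  have h3 : propagator H (-t) * propagator K (-t) = propagator K (-t) * propagator H (-t) :=
    (commute_propagator (commute_propagator h.symm (-t)).symm (-t)).eq
  calc heisenberg (H + K) t x
      = propagator K (-t) * (heisenberg H t x * propagator K t) := by
        rw [heisenberg, h1, h1, h3, heisenberg]
        noncomm_ring
    _ = heisenberg H t x := by
        rw [h2.eq, ← mul_assoc, propagator_neg_mul_self, one_mul]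

theorem norm_lie_le (x y : 𝔄) : ‖⁅x, y⁆‖ ≤ 2 * ‖x‖ * ‖y‖ := by
  rw [Ring.lie_def]
  calc _ ≤ ‖x * y‖ + ‖y * x‖ := norm_sub_le _ _
    _ ≤ ‖x‖ * ‖y‖ + ‖y‖ * ‖x‖ := add_le_add (norm_mul_le _ _) (norm_mul_le _ _)
    _ = _ := by ring

theorem norm_lie_comm (x y : 𝔄) : ‖⁅x, y⁆‖ = ‖⁅y, x⁆‖ := by
  rw [Ring.lie_def, Ring.lie_def, norm_sub_rev]

theorem norm_neg_lie (x y : 𝔄) : ‖⁅-x, y⁆‖ = ‖⁅x, y⁆‖ := by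
  rw [Ring.lie_def, Ring.lie_def, neg_mul, mul_neg, ← neg_sub', norm_neg]

/-- Conjugation by the dynamics is isometric and respects commutators, so either entry may be taken
as the moving one. -/
theorem norm_lie_heisenberg_neg {H : 𝔄} (hH : IsSelfAdjoint H) (t : ℝ) (x y : 𝔄) :
    ‖⁅heisenberg H (-t) x, y⁆‖ = ‖⁅x, heisenberg H t y⁆‖ := by
  rw [← norm_heisenberg hH (-t) ⁅x, heisenberg H t y⁆, heisenberg_lie, heisenberg_neg_heisenberg]

/-- Derivative of the dynamics of `H` in the interaction picture of `H₁`. -/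
theorem hasDerivAt_heisenberg_heisenberg (H H₁ b : 𝔄) (t : ℝ) :
    HasDerivAt (fun s => heisenberg H₁ (-s) (heisenberg H s b))
      (heisenberg H₁ (-t) (Complex.I • ⁅H - H₁, heisenberg H t b⁆)) t := by
  have hP := (hasDerivAt_propagator H₁ t).mul (hasDerivAt_propagator_neg H t)
  have hQ := (hasDerivAt_propagator H t).mul (hasDerivAt_propagator_neg H₁ t)
  have h := (hP.mul_const b).mul hQ
  convert! h using 1
  · funext s
    simp only [heisenberg, neg_neg, Pi.mul_apply]
    noncomm_ring
  · simp only [heisenberg, neg_neg, Ring.lie_def, smul_sub, mul_sub, sub_mul, add_mul, mul_add,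
      neg_smul, mul_assoc, Pi.mul_apply, smul_mul_assoc, mul_smul_comm, neg_mul, mul_neg]
    abel

theorem norm_heisenberg_neg_smul_lie {H₁ : 𝔄} (hH₁ : IsSelfAdjoint H₁) (t : ℝ) (x : 𝔄) :
    ‖heisenberg H₁ (-t) (Complex.I • x)‖ = ‖x‖ := by
  rw [norm_heisenberg hH₁, norm_smul, Complex.norm_I, one_mul]

/-- Comparison principle for the commutator of an observable with an evolved observable. -/
theorem norm_lie_heisenberg_le {H H₁ : 𝔄} (hH₁ : IsSelfAdjoint H₁)
    (a b : 𝔄) {T : ℝ} (hT : 0 ≤ T) {g g' : ℝ → ℝ} (hg : ∀ s, HasDerivAt g (g' s) s)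
    (h0 : ‖⁅heisenberg H₁ (-T) a, b⁆‖ ≤ g 0)
    (hbound : ∀ s, 0 ≤ s → 2 * ‖a‖ * ‖⁅H - H₁, heisenberg H s b⁆‖ ≤ g' s) :
    ‖⁅a, heisenberg H T b⁆‖ ≤ g T := by
  -- With `a` pulled back by the full time `T`, the commutator below is at `s = T` the
  -- `H₁`-conjugate of `⁅a, heisenberg H T b⁆`, and so has the same norm.
  set a₀ := heisenberg H₁ (-T) a with ha₀
  have hna : ‖a₀‖ = ‖a‖ := norm_heisenberg hH₁ _ _
  have hd : ∀ s, HasDerivAt (fun s => ⁅a₀, heisenberg H₁ (-s) (heisenberg H s b)⁆)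
      ⁅a₀, heisenberg H₁ (-s) (Complex.I • ⁅H - H₁, heisenberg H s b⁆)⁆ s := fun s => by
    have h := hasDerivAt_heisenberg_heisenberg H H₁ b s
    simp only [Ring.lie_def _ (heisenberg _ _ _)]
    exact (h.const_mul a₀).sub (h.mul_const a₀)
  -- The mean value inequality against a majorant `g` replaces integration of the derivative bound.
  have key := image_norm_le_of_norm_deriv_right_le_deriv_boundary (a := 0) (b := T)
    (fun s _ => (hd s).continuousAt.continuousWithinAt) (fun s _ => (hd s).hasDerivWithinAt)
    (B := g) (B' := g') (by simpa [heisenberg_zero] using h0) hg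
    (fun s hs => ((norm_lie_le _ _).trans_eq (by
      rw [norm_heisenberg_neg_smul_lie hH₁, hna])).trans (hbound s hs.1)) (Set.right_mem_Icc.2 hT)
  rwa [ha₀, ← heisenberg_lie, norm_heisenberg hH₁] at key

/-- Comparison principle for the difference of two dynamics. -/
theorem norm_heisenberg_sub_heisenberg_le {H H₁ : 𝔄} (hH₁ : IsSelfAdjoint H₁)
    (b : 𝔄) {T : ℝ} (hT : 0 ≤ T) {g g' : ℝ → ℝ} (hg : ∀ s, HasDerivAt g (g' s) s)
    (h0 : 0 ≤ g 0) (hbound : ∀ s, 0 ≤ s → ‖⁅H - H₁, heisenberg H s b⁆‖ ≤ g' s) :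
    ‖heisenberg H T b - heisenberg H₁ T b‖ ≤ g T := by
  have hd : ∀ s, HasDerivAt (fun s => heisenberg H₁ (-s) (heisenberg H s b) - b)
      (heisenberg H₁ (-s) (Complex.I • ⁅H - H₁, heisenberg H s b⁆)) s := fun s =>
    (hasDerivAt_heisenberg_heisenberg H H₁ b s).sub_const b
  have key := image_norm_le_of_norm_deriv_right_le_deriv_boundary (a := 0) (b := T)
    (fun s _ => (hd s).continuousAt.continuousWithinAt) (fun s _ => (hd s).hasDerivWithinAt)
    (B := g) (B' := g') (by simpa [heisenberg_zero] using h0) hg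
    (fun s hs => (norm_heisenberg_neg_smul_lie hH₁ _ _).trans_le (hbound s hs.1))
    (Set.right_mem_Icc.2 hT)
  rw [← norm_heisenberg hH₁ (-T), heisenberg_sub, heisenberg_neg_heisenberg]
  exact key

end Dynamics

/-! ### The Lieb–Robinson bound for abstract local terms -/

section LiebRobinson

variable {Γ : Type*} [DecidableEq Γ]

/-- Summing over the terms that meet `Y` is controlled by the pair decay of the terms. -/
theorem sum_mul_indicator_le {Λ : Finset Γ} {w : Finset Γ → ℝ} (hw : ∀ Z, 0 ≤ w Z)
    {κ : Γ → Γ → ℝ} {N : ℝ}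
    (hwκ : ∀ x y, ∑ Z ∈ Λ.powerset with x ∈ Z ∧ y ∈ Z, w Z ≤ N * κ x y) (Y : Finset Γ) (x : Γ) :
    ∑ Z ∈ Λ.powerset with x ∈ Z, w Z * (if Disjoint Z Y then 0 else 1)
      ≤ N * ∑ y ∈ Y, κ x y := by
  calc _ ≤ ∑ Z ∈ Λ.powerset with x ∈ Z, ∑ y ∈ Y, if y ∈ Z then w Z else 0 := by
        refine Finset.sum_le_sum fun Z _ => ?_
        split_ifs with h
        · rw [mul_zero]
          exact Finset.sum_nonneg fun y _ => by split_ifs <;> simp [hw]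
        · obtain ⟨y, hyZ, hyY⟩ := Finset.not_disjoint_iff.1 h
          rw [mul_one]
          calc w Z = if y ∈ Z then w Z else 0 := by rw [if_pos hyZ]
            _ ≤ _ := Finset.single_le_sum (f := fun y => if y ∈ Z then w Z else 0)
              (fun y _ => by split_ifs <;> simp [hw]) hyY
    _ = ∑ y ∈ Y, ∑ Z ∈ Λ.powerset with x ∈ Z ∧ y ∈ Z, w Z := by
        rw [Finset.sum_comm]
        refine Finset.sum_congr rfl fun y _ => ?_
        rw [← Finset.sum_filter, Finset.filter_filter]
    _ ≤ ∑ y ∈ Y, N * κ x y := Finset.sum_le_sum fun y _ => hwκ x y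
    _ = _ := by rw [Finset.mul_sum]

/-- One step of convolution of the pair decay. -/
theorem sum_mul_sum_le {Λ : Finset Γ} {w : Finset Γ → ℝ}
    {κ : Γ → Γ → ℝ} (hκ0 : ∀ x y, 0 ≤ κ x y) {N C : ℝ} (hN : 0 ≤ N)
    (hwκ : ∀ x y, ∑ Z ∈ Λ.powerset with x ∈ Z ∧ y ∈ Z, w Z ≤ N * κ x y)
    (hκ : ∀ x y, ∑ z ∈ Λ, κ x z * κ z y ≤ C * κ x y) (Y : Finset Γ) (x : Γ) :
    ∑ Z ∈ Λ.powerset with x ∈ Z, w Z * ∑ z ∈ Z, ∑ y ∈ Y, κ z y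
      ≤ N * C * ∑ y ∈ Y, κ x y := by
  calc _ = ∑ Z ∈ Λ.powerset with x ∈ Z, ∑ z ∈ Λ, if z ∈ Z then w Z * ∑ y ∈ Y, κ z y else 0 := by
        refine Finset.sum_congr rfl fun Z hZ => ?_
        have hZΛ := Finset.mem_powerset.1 (Finset.mem_filter.1 hZ).1
        rw [Finset.mul_sum, ← Finset.sum_filter, Finset.filter_mem_eq_inter,
          Finset.inter_eq_right.2 hZΛ]
    _ = ∑ z ∈ Λ, (∑ Z ∈ Λ.powerset with x ∈ Z ∧ z ∈ Z, w Z) * ∑ y ∈ Y, κ z y := by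
        rw [Finset.sum_comm]
        refine Finset.sum_congr rfl fun z _ => ?_
        rw [← Finset.sum_filter, Finset.filter_filter, Finset.sum_mul]
    _ ≤ ∑ z ∈ Λ, (N * κ x z) * ∑ y ∈ Y, κ z y := by
        refine Finset.sum_le_sum fun z _ => ?_
        exact mul_le_mul_of_nonneg_right (hwκ x z) (Finset.sum_nonneg fun y _ => hκ0 z y)
    _ = N * ∑ y ∈ Y, ∑ z ∈ Λ, κ x z * κ z y := by
        rw [Finset.sum_comm, Finset.mul_sum]
        refine Finset.sum_congr rfl fun z _ => ?_
        rw [Finset.mul_sum, Finset.mul_sum]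
        exact Finset.sum_congr rfl fun y _ => mul_assoc _ _ _
    _ ≤ N * ∑ y ∈ Y, C * κ x y :=
        mul_le_mul_of_nonneg_left (Finset.sum_le_sum fun y _ => hκ x y) hN
    _ = _ := by rw [← Finset.mul_sum, mul_assoc]

/-- A sum over terms that meet `D` is bounded by the double sum over points of `D` and terms
containing them. -/
theorem sum_filter_le_sum_sum {Λ D : Finset Γ} {p : Finset Γ → Prop} [DecidablePred p]
    {f : Finset Γ → ℝ} (hf : ∀ Z, 0 ≤ f Z)
    (hD : ∀ Z ∈ Λ.powerset, p Z → f Z ≠ 0 → ∃ x ∈ Z, x ∈ D) :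
    ∑ Z ∈ Λ.powerset with p Z, f Z ≤ ∑ x ∈ D, ∑ Z ∈ Λ.powerset with x ∈ Z, f Z := by
  have e : ∀ x ∈ D, ∑ Z ∈ Λ.powerset with x ∈ Z, f Z
      = ∑ Z ∈ Λ.powerset, if x ∈ Z then f Z else 0 := fun x _ => by rw [Finset.sum_filter]
  rw [Finset.sum_congr rfl e, Finset.sum_comm, Finset.sum_filter]
  refine Finset.sum_le_sum fun Z hZ => ?_
  have h0 : ∀ x ∈ D, 0 ≤ if x ∈ Z then f Z else 0 := fun x _ => by split_ifs <;> simp [hf]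
  split_ifs with hp
  · by_cases hfZ : f Z = 0
    · rw [hfZ]
      simp
    · obtain ⟨x, hxZ, hxD⟩ := hD Z hZ hp hfZ
      calc f Z = if x ∈ Z then f Z else 0 := by rw [if_pos hxZ]
        _ ≤ _ := Finset.single_le_sum (f := fun x => if x ∈ Z then f Z else 0) h0 hxD
  · exact Finset.sum_nonneg h0

variable {𝔄 : Type*} [CStarAlgebra 𝔄]

/-- The Lieb–Robinson bound up to a remainder that vanishes as `n → ∞`. -/
theorem norm_lie_heisenberg_sum_le_add {Λ : Finset Γ} {φ : Finset Γ → 𝔄}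
    (hsa : ∀ Z, IsSelfAdjoint (φ Z)) (hφ : ∀ Z Z', Disjoint Z Z' → Commute (φ Z) (φ Z'))
    {b : 𝔄} {Y : Finset Γ} (hb : ∀ Z, Disjoint Z Y → Commute (φ Z) b)
    {κ : Γ → Γ → ℝ} (hκ0 : ∀ x y, 0 ≤ κ x y) {N C : ℝ} (hN : 0 ≤ N) (hC : 0 < C)
    (hφκ : ∀ x y, ∑ Z ∈ Λ.powerset with x ∈ Z ∧ y ∈ Z, ‖φ Z‖ ≤ N * κ x y)
    (hκ : ∀ x y, ∑ z ∈ Λ, κ x z * κ z y ≤ C * κ x y) (n : ℕ) :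
    ∀ (X D : Finset Γ) (a : 𝔄), (∀ Z, Disjoint Z X → Commute (φ Z) a) →
      (Disjoint X Y → Commute a b) →
      (∀ Z ∈ Λ.powerset, ¬ Z ⊆ X ∧ ¬ Disjoint Z X → φ Z ≠ 0 → ∃ x ∈ Z, x ∈ D) →
      ∀ t : ℝ, 0 ≤ t → ‖⁅a, heisenberg (∑ Z ∈ Λ.powerset, φ Z) t b⁆‖
        ≤ 2 * ‖a‖ * ‖b‖ * ((if Disjoint X Y then 0 else 1)
          + (Real.exp (2 * N * C * t) - 1) / C * (∑ x ∈ D, ∑ y ∈ Y, κ x y)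
          + (2 * (∑ Z ∈ Λ.powerset, ‖φ Z‖) * t) ^ n / n.factorial) := by
  set H := ∑ Z ∈ Λ.powerset, φ Z with hHdef
  set m := ∑ Z ∈ Λ.powerset, ‖φ Z‖ with hm
  have hH : IsSelfAdjoint H := isSelfAdjoint_sum _ fun Z _ => hsa Z
  have hm0 : 0 ≤ m := Finset.sum_nonneg fun Z _ => norm_nonneg _
  have hK0 : ∀ E : Finset Γ, 0 ≤ ∑ x ∈ E, ∑ y ∈ Y, κ x y := fun E =>
    Finset.sum_nonneg fun x _ => Finset.sum_nonneg fun y _ => hκ0 x y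
  have hexp : ∀ s : ℝ, 0 ≤ s → 0 ≤ (Real.exp (2 * N * C * s) - 1) / C := fun s hs =>
    div_nonneg (sub_nonneg.2 (Real.one_le_exp (by positivity))) hC.le
  have hδ : ∀ Z : Finset Γ, (0 : ℝ) ≤ if Disjoint Z Y then 0 else 1 := fun Z => by
    split_ifs <;> simp
  induction n with
  | zero =>
    intro X D a _ _ _ t ht
    refine (norm_lie_le _ _).trans ?_
    rw [norm_heisenberg hH]
    refine le_mul_of_one_le_right (by positivity) ?_
    have := mul_nonneg (hexp t ht) (hK0 D)
    have := hδ X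
    simp only [pow_zero, Nat.factorial_zero, Nat.cast_one, div_one]
    linarith
  | succ n ih =>
    intro X D a ha hab hD t ht
    -- The terms are split by position relative to `X`: inside, disjoint, straddling. The comparison
    -- dynamics is that of `HX + HD`, and `V` is the perturbation.
    set HX := ∑ Z ∈ Λ.powerset with Z ⊆ X, φ Z with hHX
    set HD := ∑ Z ∈ Λ.powerset with ¬ Z ⊆ X ∧ Disjoint Z X, φ Z with hHD
    set V := ∑ Z ∈ Λ.powerset with ¬ Z ⊆ X ∧ ¬ Disjoint Z X, φ Z with hV
    have hsplit : H - (HX + HD) = V := by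
      rw [sub_eq_iff_eq_add, hHdef, ← Finset.sum_filter_add_sum_filter_not _ (fun Z => Z ⊆ X),
        ← Finset.sum_filter_add_sum_filter_not (Finset.filter (fun Z => ¬ Z ⊆ X) _)
          (fun Z => Disjoint Z X), Finset.filter_filter, Finset.filter_filter]
      abel
    have hsaX : IsSelfAdjoint HX := isSelfAdjoint_sum _ fun Z _ => hsa Z
    have hsaD : IsSelfAdjoint HD := isSelfAdjoint_sum _ fun Z _ => hsa Z
    have hcXD : Commute HX HD := by
      refine Commute.sum_left _ _ _ fun Z hZ => Commute.sum_right _ _ _ fun Z' hZ' => ?_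
      simp only [Finset.mem_filter] at hZ hZ'
      exact hφ _ _ (Finset.disjoint_of_subset_left hZ.2 hZ'.2.2.symm)
    have hcaD : Commute a HD := by
      refine Commute.sum_right _ _ _ fun Z hZ => ?_
      simp only [Finset.mem_filter] at hZ
      exact (ha Z hZ.2.2).symm
    have hW : ∀ s, 0 ≤ s → ‖⁅V, heisenberg H s b⁆‖ ≤ 2 * ‖b‖ *
        (N * Real.exp (2 * N * C * s) * (∑ x ∈ D, ∑ y ∈ Y, κ x y)
          + m * ((2 * m * s) ^ n / n.factorial)) := by
      intro s hs
      set r := (2 * m * s) ^ n / n.factorial with hr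
      have hr0 : 0 ≤ r := by positivity
      set g := (Real.exp (2 * N * C * s) - 1) / C with hg
      have hterm : ∀ Z, ‖⁅φ Z, heisenberg H s b⁆‖ ≤ 2 * ‖b‖ * (‖φ Z‖ *
          ((if Disjoint Z Y then 0 else 1) + g * ∑ x ∈ Z, ∑ y ∈ Y, κ x y) + ‖φ Z‖ * r) := by
        intro Z
        -- For a straddling term the whole of `Z` serves as the set `D`; only the outermost step
        -- keeps a smaller `D`.
        refine (ih Z Z (φ Z) (fun Z' h => hφ _ _ h) (hb Z) (fun Z' _ h _ => ?_) s hs).trans_eq ?_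
        · exact Finset.not_disjoint_iff.1 h.2
        · ring
      have hw : ∀ Z : Finset Γ, 0 ≤ ‖φ Z‖ *
          ((if Disjoint Z Y then 0 else 1) + g * ∑ x ∈ Z, ∑ y ∈ Y, κ x y) := fun Z =>
        mul_nonneg (norm_nonneg _) (add_nonneg (hδ Z) (mul_nonneg (hexp s hs) (hK0 Z)))
      calc ‖⁅V, heisenberg H s b⁆‖
          = ‖∑ Z ∈ Λ.powerset with ¬ Z ⊆ X ∧ ¬ Disjoint Z X, ⁅φ Z, heisenberg H s b⁆‖ := by
            simp only [hV, Ring.lie_def, Finset.sum_mul, Finset.mul_sum, Finset.sum_sub_distrib]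
        _ ≤ ∑ Z ∈ Λ.powerset with ¬ Z ⊆ X ∧ ¬ Disjoint Z X, ‖⁅φ Z, heisenberg H s b⁆‖ :=
            norm_sum_le _ _
        _ ≤ ∑ Z ∈ Λ.powerset with ¬ Z ⊆ X ∧ ¬ Disjoint Z X, 2 * ‖b‖ * (‖φ Z‖ *
              ((if Disjoint Z Y then 0 else 1) + g * ∑ x ∈ Z, ∑ y ∈ Y, κ x y) + ‖φ Z‖ * r) :=
            Finset.sum_le_sum fun Z _ => hterm Z
        _ = 2 * ‖b‖ * (∑ Z ∈ Λ.powerset with ¬ Z ⊆ X ∧ ¬ Disjoint Z X, (‖φ Z‖ *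
              ((if Disjoint Z Y then 0 else 1) + g * ∑ x ∈ Z, ∑ y ∈ Y, κ x y))
              + (∑ Z ∈ Λ.powerset with ¬ Z ⊆ X ∧ ¬ Disjoint Z X, ‖φ Z‖) * r) := by
            rw [← Finset.mul_sum, Finset.sum_add_distrib, Finset.sum_mul]
        _ ≤ _ := by
            refine mul_le_mul_of_nonneg_left (add_le_add ?_ ?_) (by positivity)
            · refine (sum_filter_le_sum_sum hw fun Z hZ hp hne =>
                hD Z hZ hp fun h => hne (by simp [h])).trans ?_
              rw [Finset.mul_sum]
              refine Finset.sum_le_sum fun x _ => ?_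
              have h1 := sum_mul_indicator_le (fun Z => norm_nonneg (φ Z)) hφκ Y x
              have h2 := sum_mul_sum_le hκ0 hN hφκ hκ Y x
              calc _ = ∑ Z ∈ Λ.powerset with x ∈ Z, ‖φ Z‖ * (if Disjoint Z Y then 0 else 1)
                    + g * ∑ Z ∈ Λ.powerset with x ∈ Z, ‖φ Z‖ * ∑ z ∈ Z, ∑ y ∈ Y, κ z y := by
                    rw [Finset.mul_sum, ← Finset.sum_add_distrib]
                    exact Finset.sum_congr rfl fun Z _ => by ring
                _ ≤ N * ∑ y ∈ Y, κ x y + g * (N * C * ∑ y ∈ Y, κ x y) :=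
                    add_le_add h1 (mul_le_mul_of_nonneg_left h2 (hexp s hs))
                -- The choice of `g` closes the iteration: `N + g N C = N e^{2NCs}`.
                _ = _ := by
                    rw [hg]
                    field_simp
                    ring
            · exact mul_le_mul_of_nonneg_right (Finset.sum_le_sum_of_subset_of_nonneg
                (Finset.filter_subset _ _) fun Z _ _ => norm_nonneg _) hr0
    refine norm_lie_heisenberg_le (hsaX.add hsaD) a b ht
      (g := fun s => 2 * ‖a‖ * ‖b‖ * ((if Disjoint X Y then 0 else 1)
          + (Real.exp (2 * N * C * s) - 1) / C * (∑ x ∈ D, ∑ y ∈ Y, κ x y)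
          + (2 * m * s) ^ (n + 1) / (n + 1).factorial))
      (g' := fun s => 2 * ‖a‖ * ‖b‖ *
        (2 * N * Real.exp (2 * N * C * s) * (∑ x ∈ D, ∑ y ∈ Y, κ x y)
          + 2 * m * ((2 * m * s) ^ n / n.factorial))) (fun s => ?_) ?_ (fun s hs => ?_)
    · have he : HasDerivAt (fun s : ℝ => Real.exp (2 * N * C * s))
          (Real.exp (2 * N * C * s) * (2 * N * C)) s := by
        simpa using ((hasDerivAt_id s).const_mul (2 * N * C)).exp
      have hp : HasDerivAt (fun s : ℝ => (2 * m * s) ^ (n + 1))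
          (((n + 1 : ℕ) : ℝ) * (2 * m * s) ^ n * (2 * m)) s := by
        have h := ((hasDerivAt_id s).const_mul (2 * m)).pow (n + 1)
        rw [mul_one, Nat.add_sub_cancel] at h
        exact h
      have h := ((((he.sub_const 1).div_const C).mul_const
        (∑ x ∈ D, ∑ y ∈ Y, κ x y)).const_add (if Disjoint X Y then (0 : ℝ) else 1)).add
          (hp.div_const ((n + 1).factorial : ℝ))
      convert! h.const_mul (2 * ‖a‖ * ‖b‖) using 1
      rw [Nat.factorial_succ]
      push_cast
      have : (n.factorial : ℝ) ≠ 0 := by positivity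
      have : (n + 1 : ℝ) ≠ 0 := by positivity
      field_simp
    -- Value at time zero: only `HX` acts on `a`, so the evolved `a` still commutes with `b` when
    -- `X` and `Y` are disjoint; otherwise the trivial bound gives the indicator.
    · rw [heisenberg_add_of_commute hcXD hcaD]
      simp only [mul_zero, Real.exp_zero, sub_self, zero_div, zero_mul, add_zero,
        ne_eq, Nat.succ_ne_zero, not_false_eq_true, zero_pow]
      by_cases hXY : Disjoint X Y
      · have hbX : Commute b HX := by
          refine Commute.sum_right _ _ _ fun Z hZ => ?_
          exact (hb Z (Finset.disjoint_of_subset_left (Finset.mem_filter.1 hZ).2 hXY)).symm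
        have := commute_heisenberg hbX (hab hXY) (-t)
        rw [Ring.lie_def, this.eq, sub_self, norm_zero, if_pos hXY, mul_zero]
      · rw [if_neg hXY, mul_one]
        refine (norm_lie_le _ _).trans_eq ?_
        rw [norm_heisenberg hsaX]
    · rw [hsplit]
      calc 2 * ‖a‖ * ‖⁅V, heisenberg H s b⁆‖ ≤ 2 * ‖a‖ * _ :=
            mul_le_mul_of_nonneg_left (hW s hs) (by positivity)
        _ = _ := by ring

/-- **Lieb–Robinson bound**, for forward times. -/
theorem norm_lie_heisenberg_sum_le_of_nonneg {Λ : Finset Γ} {φ : Finset Γ → 𝔄}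
    (hsa : ∀ Z, IsSelfAdjoint (φ Z)) (hφ : ∀ Z Z', Disjoint Z Z' → Commute (φ Z) (φ Z'))
    {κ : Γ → Γ → ℝ} (hκ0 : ∀ x y, 0 ≤ κ x y) {N C : ℝ} (hN : 0 ≤ N) (hC : 0 < C)
    (hφκ : ∀ x y, ∑ Z ∈ Λ.powerset with x ∈ Z ∧ y ∈ Z, ‖φ Z‖ ≤ N * κ x y)
    (hκ : ∀ x y, ∑ z ∈ Λ, κ x z * κ z y ≤ C * κ x y)
    {a b : 𝔄} {X Y D : Finset Γ} (ha : ∀ Z, Disjoint Z X → Commute (φ Z) a)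
    (hb : ∀ Z, Disjoint Z Y → Commute (φ Z) b) (hXY : Disjoint X Y) (hab : Commute a b)
    (hD : ∀ Z ∈ Λ.powerset, ¬ Z ⊆ X ∧ ¬ Disjoint Z X → φ Z ≠ 0 → ∃ x ∈ Z, x ∈ D)
    {t : ℝ} (ht : 0 ≤ t) :
    ‖⁅a, heisenberg (∑ Z ∈ Λ.powerset, φ Z) t b⁆‖
      ≤ 2 * ‖a‖ * ‖b‖ * ((Real.exp (2 * N * C * t) - 1) / C * (∑ x ∈ D, ∑ y ∈ Y, κ x y)) := by
  have h := fun n => norm_lie_heisenberg_sum_le_add (Λ := Λ) hsa hφ hb hκ0 hN hC hφκ hκ n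
    X D a ha (fun _ => hab) hD t ht
  simp only [if_pos hXY, zero_add] at h
  refine ge_of_tendsto' (x := Filter.atTop) ?_ h
  have := FloorSemiring.tendsto_pow_div_factorial_atTop (2 * (∑ Z ∈ Λ.powerset, ‖φ Z‖) * t)
  simpa using (this.const_add ((Real.exp (2 * N * C * t) - 1) / C *
    (∑ x ∈ D, ∑ y ∈ Y, κ x y))).const_mul (2 * ‖a‖ * ‖b‖)

/-- **Lieb–Robinson bound**. -/
theorem norm_lie_heisenberg_sum_le {Λ : Finset Γ} {φ : Finset Γ → 𝔄}
    (hsa : ∀ Z, IsSelfAdjoint (φ Z)) (hφ : ∀ Z Z', Disjoint Z Z' → Commute (φ Z) (φ Z'))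
    {κ : Γ → Γ → ℝ} (hκ0 : ∀ x y, 0 ≤ κ x y) {N C : ℝ} (hN : 0 ≤ N) (hC : 0 < C)
    (hφκ : ∀ x y, ∑ Z ∈ Λ.powerset with x ∈ Z ∧ y ∈ Z, ‖φ Z‖ ≤ N * κ x y)
    (hκ : ∀ x y, ∑ z ∈ Λ, κ x z * κ z y ≤ C * κ x y)
    {a b : 𝔄} {X Y D : Finset Γ} (ha : ∀ Z, Disjoint Z X → Commute (φ Z) a)
    (hb : ∀ Z, Disjoint Z Y → Commute (φ Z) b) (hXY : Disjoint X Y) (hab : Commute a b)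
    (hD : ∀ Z ∈ Λ.powerset, ¬ Z ⊆ X ∧ ¬ Disjoint Z X → φ Z ≠ 0 → ∃ x ∈ Z, x ∈ D) (t : ℝ) :
    ‖⁅a, heisenberg (∑ Z ∈ Λ.powerset, φ Z) t b⁆‖
      ≤ 2 * ‖a‖ * ‖b‖ * ((Real.exp (2 * N * C * |t|) - 1) / C * (∑ x ∈ D, ∑ y ∈ Y, κ x y)) := by
  rcases le_total 0 t with ht | ht
  · rw [abs_of_nonneg ht]
    exact norm_lie_heisenberg_sum_le_of_nonneg hsa hφ hκ0 hN hC hφκ hκ ha hb hXY hab hD ht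
  · rw [abs_of_nonpos ht]
    -- Negative times are forward times for the interaction `-φ`.
    have := norm_lie_heisenberg_sum_le_of_nonneg (Λ := Λ) (φ := fun Z => -φ Z)
      (fun Z => (hsa Z).neg) (fun Z Z' h => (hφ Z Z' h).neg_left.neg_right) hκ0 hN hC
      (by simpa using hφκ) hκ (fun Z h => (ha Z h).neg_left) (fun Z h => (hb Z h).neg_left)
      hXY hab (by simpa using hD) (neg_nonneg.2 ht)
    rwa [Finset.sum_neg_distrib, heisenberg_neg, neg_neg] at this

end LiebRobinson

/-! ### Tensor embeddings, locality and the partial trace -/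

section Embedding

variable {Γ : Type*} [DecidableEq Γ] {S : Γ → Type*}

theorem glue_apply_mem {Y Λ : Finset Γ} (α : Cfg S Y) (γ : Cfg S (Λ \ Y)) {i : Γ} (hΛ : i ∈ Λ)
    (hi : i ∈ Y) : glue α γ ⟨i, hΛ⟩ = α ⟨i, hi⟩ := dif_pos hi

theorem glue_apply_notMem {Y Λ : Finset Γ} (α : Cfg S Y) (γ : Cfg S (Λ \ Y)) {i : Γ} (hΛ : i ∈ Λ)
    (hi : i ∉ Y) : glue α γ ⟨i, hΛ⟩ = γ ⟨i, Finset.mem_sdiff.2 ⟨hΛ, hi⟩⟩ := dif_neg hi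

/-- A configuration on `Λ` is a pair of configurations on `Y` and on `Λ \ Y`. -/
def glueEquiv {Y Λ : Finset Γ} (h : Y ⊆ Λ) : Cfg S Y × Cfg S (Λ \ Y) ≃ Cfg S Λ where
  toFun p := glue p.1 p.2
  invFun σ := (fun i => σ ⟨i, h i.2⟩, fun i => σ ⟨i, (Finset.mem_sdiff.1 i.2).1⟩)
  left_inv p := by
    ext i
    · exact glue_apply_mem _ _ (h i.2) i.2
    · exact glue_apply_notMem _ _ (Finset.mem_sdiff.1 i.2).1 (Finset.mem_sdiff.1 i.2).2
  right_inv σ := by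
    ext i
    by_cases hi : (i : Γ) ∈ Y
    · exact glue_apply_mem _ _ i.2 hi
    · exact glue_apply_notMem _ _ i.2 hi

variable [∀ i, DecidableEq (S i)]

theorem embed_glue {Y Λ : Finset Γ} (h : Y ⊆ Λ) (A : Op S Y) (α β : Cfg S Y)
    (γ δ : Cfg S (Λ \ Y)) :
    embed h A (glue α γ) (glue β δ) = A α β * (1 : Op S (Λ \ Y)) γ δ := by
  have h1 : ∀ (α : Cfg S Y) (γ : Cfg S (Λ \ Y)),
      (fun i : Y => glue α γ (⟨i, h i.2⟩ : Λ)) = α := fun α γ => by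
    ext i
    exact glue_apply_mem _ _ (h i.2) i.2
  have h2 : (∀ i : Λ, (i : Γ) ∉ Y → glue α γ i = glue β δ i) ↔ γ = δ := by
    constructor
    · intro H
      ext i
      obtain ⟨hΛ, hi⟩ := Finset.mem_sdiff.1 i.2
      exact (glue_apply_notMem α γ hΛ hi).symm.trans
        ((H ⟨i, hΛ⟩ hi).trans (glue_apply_notMem β δ hΛ hi))
    · rintro rfl i hi
      rw [glue_apply_notMem _ _ i.2 hi, glue_apply_notMem _ _ i.2 hi]
  rw [embed, Matrix.of_apply, h1, h1]
  by_cases hγ : γ = δ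
  · rw [if_pos (h2.2 hγ), hγ, Matrix.one_apply_eq, mul_one]
  · rw [if_neg (mt h2.1 hγ), Matrix.one_apply_ne hγ, mul_zero]

open scoped Kronecker in
theorem embed_eq_submatrix {Y Λ : Finset Γ} (h : Y ⊆ Λ) (A : Op S Y) :
    embed h A = (A ⊗ₖ (1 : Op S (Λ \ Y))).submatrix (glueEquiv h).symm (glueEquiv h).symm := by
  ext σ τ
  obtain ⟨⟨α, γ⟩, rfl⟩ := (glueEquiv h).surjective σ
  obtain ⟨⟨β, δ⟩, rfl⟩ := (glueEquiv h).surjective τ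
  simp only [Matrix.submatrix_apply, Equiv.symm_apply_apply, Matrix.kroneckerMap_apply]
  exact embed_glue h A α β γ δ

variable [∀ i, Fintype (S i)]

/-- `A ↦ A ⊗ 1` as a homomorphism of star algebras. -/
noncomputable def embedHom {Y Λ : Finset Γ} (h : Y ⊆ Λ) : Op S Y →⋆ₙₐ[ℂ] Op S Λ where
  toFun := embed h
  map_smul' c A := by simp [embed_eq_submatrix, Matrix.smul_kronecker, Matrix.submatrix_smul]
  map_zero' := by simp [embed_eq_submatrix]
  map_add' A B := by simp [embed_eq_submatrix, Matrix.add_kronecker, Matrix.submatrix_add]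
  map_mul' A B := by
    simp only [embed_eq_submatrix]
    rw [Matrix.submatrix_mul_equiv, ← Matrix.mul_kronecker_mul, mul_one]
  map_star' A := by
    simp only [embed_eq_submatrix, Matrix.star_eq_conjTranspose, Matrix.conjTranspose_submatrix,
      Matrix.conjTranspose_kronecker, Matrix.conjTranspose_one]

/-- Homomorphisms of C*-algebras are contractive. Equality can fail: `H_Λ` is zero when a site of `Λ
\ Y` has an empty basis. -/
theorem norm_embed_le {Y Λ : Finset Γ} (h : Y ⊆ Λ) (A : Op S Y) : ‖embed h A‖ ≤ ‖A‖ :=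
  NonUnitalStarAlgHom.norm_apply_le (embedHom h) A

theorem isSelfAdjoint_embed {Y Λ : Finset Γ} (h : Y ⊆ Λ) {A : Op S Y} (hA : A.IsHermitian) :
    IsSelfAdjoint (embed h A) :=
  IsSelfAdjoint.map hA (embedHom h)

theorem embed_mul_embed_apply {X Z Λ : Finset Γ} (hX : X ⊆ Λ) (hZ : Z ⊆ Λ) (hXZ : Disjoint X Z)
    (A : Op S X) (B : Op S Z) (σ τ : Cfg S Λ) :
    (embed hX A * embed hZ B) σ τ = if ∀ i : Λ, (i : Γ) ∉ X → (i : Γ) ∉ Z → σ i = τ i then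
      A (fun i => σ ⟨i, hX i.2⟩) (fun i => τ ⟨i, hX i.2⟩)
        * B (fun i => σ ⟨i, hZ i.2⟩) (fun i => τ ⟨i, hZ i.2⟩) else 0 := by
  rw [Matrix.mul_apply]
  -- The only intermediate configuration that can contribute: the second factor fixes it to `τ` on
  -- `X`, the first to `σ` off `X`.
  set ρ : Cfg S Λ := fun i => if (i : Γ) ∈ X then τ i else σ i with hρ
  rw [Finset.sum_eq_single ρ]
  · have h1 : ∀ i : Λ, (i : Γ) ∉ X → σ i = ρ i := fun i hi => by simp [hρ, hi]
    have h2 : (∀ i : Λ, (i : Γ) ∉ Z → ρ i = τ i) ↔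
        ∀ i : Λ, (i : Γ) ∉ X → (i : Γ) ∉ Z → σ i = τ i := by
      refine forall_congr' fun i => ?_
      by_cases hi : (i : Γ) ∈ X <;> simp [hρ, hi]
    have h3 : (fun i : X => ρ ⟨i, hX i.2⟩) = fun i : X => τ ⟨i, hX i.2⟩ := by
      ext i
      simp [hρ]
    have h4 : (fun i : Z => ρ ⟨i, hZ i.2⟩) = fun i : Z => σ ⟨i, hZ i.2⟩ := by
      ext i
      simp [hρ, Finset.disjoint_right.1 hXZ i.2]
    rw [embed, embed, Matrix.of_apply, Matrix.of_apply, if_pos h1, h3, h4]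
    simp only [h2, mul_ite, mul_zero]
  · intro κ _ hκ
    by_contra hne
    refine hκ ?_
    obtain ⟨hA, hB⟩ := mul_ne_zero_iff.1 hne
    rw [embed, Matrix.of_apply] at hA hB
    have hA' := (ite_ne_right_iff.1 hA).1
    have hB' := (ite_ne_right_iff.1 hB).1
    ext i
    by_cases hi : (i : Γ) ∈ X
    · simp only [hρ, if_pos hi]
      exact hB' i (Finset.disjoint_left.1 hXZ hi)
    · simp only [hρ, if_neg hi]
      exact (hA' i hi).symm
  · intro h
    exact absurd (Finset.mem_univ _) h

/-- The entry formula for the product is symmetric under exchange of the two factors. -/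
theorem commute_embed {X Z Λ : Finset Γ} (hX : X ⊆ Λ) (hZ : Z ⊆ Λ) (hXZ : Disjoint X Z)
    (A : Op S X) (B : Op S Z) : Commute (embed hX A) (embed hZ B) := by
  ext σ τ
  rw [embed_mul_embed_apply hX hZ hXZ, embed_mul_embed_apply hZ hX hXZ.symm]
  simp only [mul_comm (A _ _)]
  exact if_congr ⟨fun h i h1 h2 => h i h2 h1, fun h i h1 h2 => h i h2 h1⟩ rfl rfl

/-- Duality of partial trace and embedding: the identity factor of `embed h B` forces equal
configurations on `Λ \ Y`, which is the sum defining the partial trace. -/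
theorem trace_partialTrace_mul {Y Λ : Finset Γ} (h : Y ⊆ Λ) (M : Op S Λ) (B : Op S Y) :
    (partialTrace Y M * B).trace = (M * embed h B).trace := by
  simp only [Matrix.trace, Matrix.diag_apply, Matrix.mul_apply]
  rw [← (glueEquiv h).sum_comp, Fintype.sum_prod_type]
  refine Finset.sum_congr rfl fun α _ => ?_
  have : ∀ γ, ∑ τ, M (glueEquiv h (α, γ)) τ * embed h B τ (glueEquiv h (α, γ))
      = ∑ β, M (glue α γ) (glue β γ) * B β α := fun γ => by
    rw [← (glueEquiv h).sum_comp, Fintype.sum_prod_type]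
    refine Finset.sum_congr rfl fun β _ => ?_
    have e : ∀ δ, M (glueEquiv h (α, γ)) (glueEquiv h (β, δ))
        * embed h B (glueEquiv h (β, δ)) (glueEquiv h (α, γ))
        = M (glue α γ) (glue β δ) * (B β α * (1 : Op S (Λ \ Y)) δ γ) := fun δ => by
      rw [← embed_glue h B β α δ γ]
      rfl
    simp only [e]
    rw [Finset.sum_eq_single γ (fun δ _ hδ => by rw [Matrix.one_apply_ne hδ]; simp) (by simp),
      Matrix.one_apply_eq, mul_one]
  simp only [this]
  rw [Finset.sum_comm]
  refine Finset.sum_congr rfl fun β _ => ?_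
  rw [partialTrace, Matrix.of_apply, Finset.sum_mul]

end Embedding

/-! ### From reduced states to norms of Heisenberg observables -/

section States

variable {Γ : Type*} [DecidableEq Γ] {S : Γ → Type*} [∀ i, Fintype (S i)] [∀ i, DecidableEq (S i)]

/-- The condition `0 ≤ r` covers an empty family of test operators, whose real supremum is `0`. -/
theorem traceNorm_le {n : Type*} [Fintype n] [DecidableEq n] {A : Matrix n n ℂ} {r : ℝ}
    (hr : 0 ≤ r) (h : ∀ B : Matrix n n ℂ, ‖B‖ = 1 → ‖(A * B).trace‖ ≤ r) : traceNorm A ≤ r :=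
  Real.iSup_le (fun B => h B B.2) hr

theorem trace_reducedState_mul {Y Λ : Finset Γ} (h : Y ⊆ Λ) (ψ : Hilb S Λ) (B : Op S Y) :
    (reducedState Y ψ * B).trace = inner ℂ ψ (Matrix.toEuclideanLin (embed h B) ψ) := by
  rw [reducedState, trace_partialTrace_mul h]
  simp only [Matrix.trace, Matrix.diag_apply, Matrix.mul_apply, Matrix.of_apply,
    PiLp.inner_apply, RCLike.inner_apply, Matrix.toLpLin_apply, Matrix.mulVec, dotProduct]
  rw [Finset.sum_comm]
  refine Finset.sum_congr rfl fun τ _ => ?_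
  rw [Finset.sum_mul]
  refine Finset.sum_congr rfl fun σ _ => ?_
  simp only [RCLike.star_def]
  ring

theorem inner_toEuclideanLin_toEuclideanLin {n : Type*} [Fintype n] [DecidableEq n]
    (P B : Matrix n n ℂ) (ψ : EuclideanSpace ℂ n) :
    inner ℂ (Matrix.toEuclideanLin P ψ) (Matrix.toEuclideanLin B (Matrix.toEuclideanLin P ψ))
      = inner ℂ ψ (Matrix.toEuclideanLin (star P * B * P) ψ) := by
  simp only [← Matrix.coe_toEuclideanCLM_eq_toEuclideanLin, map_mul, map_star,
    ContinuousLinearMap.star_eq_adjoint]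
  exact (ContinuousLinearMap.adjoint_inner_right _ _ _).symm

theorem norm_inner_sub_inner_le {n : Type*} [Fintype n] [DecidableEq n]
    (A B : Matrix n n ℂ) {ψ : EuclideanSpace ℂ n} (hψ : ‖ψ‖ = 1) :
    ‖inner ℂ ψ (Matrix.toEuclideanLin A ψ) - inner ℂ ψ (Matrix.toEuclideanLin B ψ)‖
      ≤ ‖A - B‖ := by
  rw [← inner_sub_right, ← LinearMap.sub_apply, ← map_sub]
  refine (norm_inner_le_norm _ _).trans ?_
  have := Matrix.l2_opNorm_mulVec (A - B) ψ
  rw [hψ, mul_one] at this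
  rw [hψ, one_mul]
  exact this

theorem evolve_eq {Λ : Finset Γ} (H : Op S Λ) (t : ℝ) (ψ : Hilb S Λ) :
    evolve H t ψ = Matrix.toEuclideanLin (propagator H t) ψ := rfl

theorem inner_evolve {Λ : Finset Γ} {H : Op S Λ} (hH : IsSelfAdjoint H) (t : ℝ) (B : Op S Λ)
    (ψ : Hilb S Λ) :
    inner ℂ (evolve H t ψ) (Matrix.toEuclideanLin B (evolve H t ψ))
      = inner ℂ ψ (Matrix.toEuclideanLin (heisenberg H t B) ψ) := by
  rw [evolve_eq, inner_toEuclideanLin_toEuclideanLin, star_propagator hH, heisenberg]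

/-- Comparison of reduced states through the Heisenberg evolution of two Hamiltonians. -/
theorem traceNorm_reducedState_evolve_sub_le {Y Λ : Finset Γ} (hY : Y ⊆ Λ) {H H₁ : Op S Λ}
    (hH : IsSelfAdjoint H) (hH₁ : IsSelfAdjoint H₁) {ψ : Hilb S Λ} (hψ : ‖ψ‖ = 1) (t : ℝ) {r : ℝ}
    (hr : 0 ≤ r) (h : ∀ B : Op S Y, ‖B‖ = 1 →
      ‖heisenberg H t (embed hY B) - heisenberg H₁ t (embed hY B)‖ ≤ r) :
    traceNorm (reducedState Y (evolve H t ψ) - reducedState Y (evolve H₁ t ψ)) ≤ r := by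
  refine traceNorm_le hr fun B hB => ?_
  rw [sub_mul, Matrix.trace_sub, trace_reducedState_mul hY, trace_reducedState_mul hY,
    inner_evolve hH, inner_evolve hH₁]
  exact (norm_inner_sub_inner_le _ _ hψ).trans (h B hB)

/-- Comparison of reduced states for a local unitary perturbation of the initial state. -/
theorem traceNorm_reducedState_evolve_unitary_sub_le {Y Λ : Finset Γ} (hY : Y ⊆ Λ) {H U : Op S Λ}
    (hH : IsSelfAdjoint H) (hU : U ∈ unitary (Op S Λ)) {ψ : Hilb S Λ} (hψ : ‖ψ‖ = 1) (t : ℝ)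
    {r : ℝ} (hr : 0 ≤ r) (h : ∀ B : Op S Y, ‖B‖ = 1 → ‖⁅U, heisenberg H t (embed hY B)⁆‖ ≤ r) :
    traceNorm (reducedState Y (evolve H t ψ)
      - reducedState Y (evolve H t (Matrix.toEuclideanLin U ψ))) ≤ r := by
  refine traceNorm_le hr fun B hB => ?_
  rw [sub_mul, Matrix.trace_sub, trace_reducedState_mul hY, trace_reducedState_mul hY,
    inner_evolve hH, inner_evolve hH, inner_toEuclideanLin_toEuclideanLin]
  refine (norm_inner_sub_inner_le _ _ hψ).trans (le_trans (le_of_eq ?_) (h B hB))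
  set C := heisenberg H t (embed hY B)
  have e : C - star U * C * U = star U * ⁅U, C⁆ := by
    rw [Ring.lie_def, mul_sub, ← mul_assoc, ← mul_assoc, Unitary.star_mul_self_of_mem hU, one_mul]
  rw [e, CStarRing.norm_mem_unitary_mul _ (Unitary.star_mem hU)]

end States

/-! ### Decay weights and distances -/

section Geometry

variable {Γ : Type*} {G : SimpleGraph Γ} {F : ℝ → ℝ}

theorem setDist_le {X Y : Finset Γ} {x y : Γ} (hx : x ∈ X) (hy : y ∈ Y) :
    setDist G X Y ≤ G.dist x y :=
  Nat.sInf_le ⟨x, hx, y, hy, rfl⟩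

theorem setDist_comm (X Y : Finset Γ) : setDist G X Y = setDist G Y X := by
  unfold setDist
  congr 1
  ext n
  constructor <;> rintro ⟨i, hi, j, hj, rfl⟩ <;> exact ⟨j, hj, i, hi, G.dist_comm⟩

theorem disjoint_of_setDist_pos {X Y : Finset Γ} (h : 0 < setDist G X Y) : Disjoint X Y :=
  Finset.disjoint_left.2 fun x hx hy => by simpa using h.trans_le (setDist_le hx hy)

/-- Since `sInf ∅ = 0`, a positive distance already forces both sets to be nonempty. -/
theorem nonempty_of_setDist_pos {X Y : Finset Γ} (h : 0 < setDist G X Y) : Nonempty Γ := by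
  obtain ⟨_, i, _, _⟩ := Nat.nonempty_of_pos_sInf h
  exact ⟨i⟩

/-- The weighted decay `e^{-μ d(x,y)} F(d(x,y))`. -/
noncomputable def weight (G : SimpleGraph Γ) (F : ℝ → ℝ) (μ : ℝ) (x y : Γ) : ℝ :=
  Real.exp (-μ * (G.dist x y : ℝ)) * F (G.dist x y)

theorem weight_pos (hF : IsDecayFunction G F) (μ : ℝ) (x y : Γ) : 0 < weight G F μ x y :=
  mul_pos (Real.exp_pos _) (hF.pos _ (Nat.cast_nonneg _))

/-- The term `i = j = k` of the supremum equals `F 0 > 0`. -/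
theorem convConst_toReal_pos [Nonempty Γ] (hF : IsDecayFunction G F) {μ : ℝ} (hμ : 0 ≤ μ) :
    0 < (convConst G F μ).toReal := by
  refine ENNReal.toReal_pos (fun h => ?_) (hF.conv_lt_top μ hμ).ne
  obtain ⟨i⟩ := ‹Nonempty Γ›
  simp only [convConst, ENNReal.iSup_eq_zero, ENNReal.tsum_eq_zero, ENNReal.ofReal_eq_zero] at h
  have h0 := hF.pos 0 le_rfl
  have := h i i i
  simp only [SimpleGraph.dist_self, Nat.cast_zero, add_zero, sub_zero, mul_zero, Real.exp_zero,
    one_mul] at this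
  exact absurd this (not_le.2 (by positivity))

/-- Dividing by `weight G F μ x y` merges the exponentials into the summand of `C_μ`, so `C_μ` is
the convolution constant of the weight. -/
theorem sum_weight_mul_weight_le (hF : IsDecayFunction G F) {μ : ℝ} (hμ : 0 ≤ μ) (Λ : Finset Γ)
    (x y : Γ) : ∑ z ∈ Λ, weight G F μ x z * weight G F μ z y
      ≤ (convConst G F μ).toReal * weight G F μ x y := by
  have hw := weight_pos hF μ x y
  have hFp : ∀ a b : Γ, 0 < F (G.dist a b) := fun a b => hF.pos _ (Nat.cast_nonneg _)
  rw [← div_le_iff₀ hw, Finset.sum_div]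
  have e : ∀ z ∈ Λ, weight G F μ x z * weight G F μ z y / weight G F μ x y =
      Real.exp (-μ * ((G.dist x z : ℝ) + G.dist z y - G.dist x y))
        * F (G.dist x z) * F (G.dist z y) / F (G.dist x y) := fun z _ => by
    rw [mul_sub, mul_add, Real.exp_sub, Real.exp_add]
    simp only [weight]
    have := (hFp x y).ne'
    field_simp
  rw [Finset.sum_congr rfl e, ← ENNReal.ofReal_le_iff_le_toReal (hF.conv_lt_top μ hμ).ne,
    ENNReal.ofReal_sum_of_nonneg fun z _ => by
      have := (hFp x z).le
      have := (hFp z y).le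
      have := (hFp x y).le
      positivity]
  exact (ENNReal.sum_le_tsum Λ).trans (le_iSup₂_of_le x y le_rfl)

theorem sum_decay_le (hF : IsDecayFunction G F) (Y : Finset Γ) (x : Γ) :
    ∑ y ∈ Y, F (G.dist x y) ≤ (decayNorm G F).toReal := by
  rw [← ENNReal.ofReal_le_iff_le_toReal hF.norm_lt_top.ne,
    ENNReal.ofReal_sum_of_nonneg fun y _ => (hF.pos _ (Nat.cast_nonneg _)).le]
  exact (ENNReal.sum_le_tsum Y).trans (le_iSup_of_le x le_rfl)

/-- The exponential factor is at most its value at the distance of the sets, and the remaining sum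
of `F` over `Y` is at most `‖F‖`. -/
theorem sum_sum_weight_le (hF : IsDecayFunction G F) {μ : ℝ} (hμ : 0 ≤ μ) {X Y D : Finset Γ}
    (hD : D ⊆ X) : ∑ x ∈ D, ∑ y ∈ Y, weight G F μ x y
      ≤ D.card * ((decayNorm G F).toReal * Real.exp (-μ * setDist G X Y)) := by
  rw [← nsmul_eq_mul]
  refine Finset.sum_le_card_nsmul _ _ _ fun x hx => ?_
  calc _ ≤ ∑ y ∈ Y, Real.exp (-μ * setDist G X Y) * F (G.dist x y) := by
        refine Finset.sum_le_sum fun y hy => mul_le_mul_of_nonneg_right ?_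
          (hF.pos _ (Nat.cast_nonneg _)).le
        have : (setDist G X Y : ℝ) ≤ G.dist x y := by exact_mod_cast setDist_le (hD hx) hy
        exact Real.exp_le_exp.2 (by nlinarith)
    _ ≤ _ := by
        rw [← Finset.mul_sum, mul_comm]
        exact mul_le_mul_of_nonneg_right (sum_decay_le hF Y x) (Real.exp_pos _).le

theorem exists_mem_phiBoundary {S : Γ → Type*} {Φ : (Z : Finset Γ) → Op S Z} (X : Finset Γ) {Z : Finset Γ}
    (hZ : ¬ Z ⊆ X ∧ ¬ Disjoint Z X) (h : Φ Z ≠ 0) : ∃ x ∈ Z, x ∈ phiBoundary Φ X := by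
  obtain ⟨x, hxZ, hxX⟩ := Finset.not_disjoint_iff.1 hZ.2
  obtain ⟨k, hkZ, hkX⟩ := Finset.not_subset.1 hZ.1
  refine ⟨x, hxZ, ?_⟩
  classical
  unfold phiBoundary
  exact Finset.mem_filter.2 ⟨hxX, Z, ⟨k, hkZ, hkX⟩, hxZ, h⟩

theorem phiBoundary_subset {S : Γ → Type*} {Φ : (Z : Finset Γ) → Op S Z} (X : Finset Γ) : phiBoundary Φ X ⊆ X := by
  classical
  exact Finset.filter_subset _ _

end Geometry

/-! ### The Lieb–Robinson bound for the lattice Hamiltonian -/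

section Interaction

variable {Γ : Type*} [DecidableEq Γ] {S : Γ → Type*} [∀ i, DecidableEq (S i)]

/-- The interaction term of `Z` as an operator on `H_Λ`, zero unless `Z ⊆ Λ`. -/
noncomputable def localTerm (Φ : (Z : Finset Γ) → Op S Z) (Λ Z : Finset Γ) : Op S Λ :=
  if h : Z ⊆ Λ then embed h (Φ Z) else 0

variable {Φ : (Z : Finset Γ) → Op S Z} {Λ : Finset Γ}

theorem hamiltonian_eq_sum : hamiltonian Φ Λ = ∑ Z ∈ Λ.powerset, localTerm Φ Λ Z := by
  rw [hamiltonian, ← Finset.sum_attach Λ.powerset]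
  refine Finset.sum_congr rfl fun Z _ => ?_
  rw [localTerm, dif_pos (Finset.mem_powerset.1 Z.2)]

variable [∀ i, Fintype (S i)]

theorem isSelfAdjoint_localTerm (hΦ : ∀ Z, (Φ Z).IsHermitian) (Z : Finset Γ) :
    IsSelfAdjoint (localTerm Φ Λ Z) := by
  unfold localTerm
  split_ifs with h
  · exact isSelfAdjoint_embed h (hΦ Z)
  · exact IsSelfAdjoint.zero _

theorem isSelfAdjoint_hamiltonian (hΦ : ∀ Z, (Φ Z).IsHermitian) :
    IsSelfAdjoint (hamiltonian Φ Λ) := by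
  rw [hamiltonian_eq_sum]
  exact isSelfAdjoint_sum _ fun Z _ => isSelfAdjoint_localTerm hΦ Z

theorem commute_localTerm_of_supportedOn {X : Finset Γ} {hX : X ⊆ Λ} {A : Op S Λ}
    (hA : SupportedOn hX A) (Z : Finset Γ) (h : Disjoint Z X) : Commute (localTerm Φ Λ Z) A := by
  obtain ⟨A, rfl⟩ := hA
  unfold localTerm
  split_ifs with hZ
  · exact commute_embed hZ hX h _ _
  · exact Commute.zero_left _

theorem commute_localTerm (Z Z' : Finset Γ) (h : Disjoint Z Z') :
    Commute (localTerm Φ Λ Z) (localTerm Φ Λ Z') := by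
  by_cases hZ' : Z' ⊆ Λ
  · exact commute_localTerm_of_supportedOn (hX := hZ') ⟨Φ Z', dif_pos hZ'⟩ Z h
  · rw [localTerm, localTerm, dif_neg hZ']
    exact Commute.zero_right _

theorem norm_localTerm_le (Z : Finset Γ) : ‖localTerm Φ Λ Z‖ ≤ ‖Φ Z‖ := by
  unfold localTerm
  split_ifs with h
  · exact norm_embed_le h _
  · simp

theorem ne_zero_of_localTerm_ne_zero {Z : Finset Γ} (h : localTerm Φ Λ Z ≠ 0) : Φ Z ≠ 0 :=
  fun h0 => h (norm_le_zero_iff.1 ((norm_localTerm_le Z).trans_eq (by rw [h0, norm_zero])))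

theorem sum_norm_localTerm_le {G : SimpleGraph Γ} {F : ℝ → ℝ} (hF : IsDecayFunction G F) {μ : ℝ}
    (hΦμ : interactionNorm G F Φ μ < ⊤) (x y : Γ) :
    ∑ Z ∈ Λ.powerset with x ∈ Z ∧ y ∈ Z, ‖localTerm Φ Λ Z‖
      ≤ (interactionNorm G F Φ μ).toReal * weight G F μ x y := by
  have hw := weight_pos hF μ x y
  refine (Finset.sum_le_sum fun Z _ => norm_localTerm_le Z).trans ?_
  rw [← div_le_iff₀ hw, Finset.sum_div, ← ENNReal.ofReal_le_iff_le_toReal hΦμ.ne,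
    ENNReal.ofReal_sum_of_nonneg fun Z _ => div_nonneg (norm_nonneg _) hw.le,
    ← Finset.sum_subtype_of_mem (p := fun Z => x ∈ Z ∧ y ∈ Z) _
      fun Z hZ => (Finset.mem_filter.1 hZ).2]
  exact (ENNReal.sum_le_tsum _).trans (le_iSup₂_of_le x y le_rfl)

theorem SupportedOn.commute {X Y : Finset Γ} {hX : X ⊆ Λ} {hY : Y ⊆ Λ} {A B : Op S Λ}
    (hA : SupportedOn hX A) (hB : SupportedOn hY B) (h : Disjoint X Y) : Commute A B := by
  obtain ⟨A, rfl⟩ := hA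
  obtain ⟨B, rfl⟩ := hB
  exact commute_embed hX hY h A B

theorem mul_velocity {G : SimpleGraph Γ} {F : ℝ → ℝ} {μ : ℝ} (hμ : 0 < μ) :
    μ * velocity G F Φ μ
      = 2 * (interactionNorm G F Φ μ).toReal * (convConst G F μ).toReal := by
  unfold velocity
  field_simp

theorem velocity_nonneg {G : SimpleGraph Γ} {F : ℝ → ℝ} {μ : ℝ} (hμ : 0 < μ) :
    0 ≤ velocity G F Φ μ := by
  unfold velocity
  positivity

/-- Lieb–Robinson bound with the boundary of the support of the observable at rest. -/
theorem norm_lie_heisenberg_hamiltonian_le_card {G : SimpleGraph Γ} {F : ℝ → ℝ}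
    (hΦ : ∀ Z, (Φ Z).IsHermitian) (hF : IsDecayFunction G F) {X Y : Finset Γ} {hX : X ⊆ Λ}
    {hY : Y ⊆ Λ} (hXY : 0 < setDist G X Y) {A B : Op S Λ} (hA : SupportedOn hX A)
    (hB : SupportedOn hY B) {μ : ℝ} (hμ : 0 < μ) (hΦμ : interactionNorm G F Φ μ < ⊤) (t : ℝ) :
    ‖⁅A, heisenberg (hamiltonian Φ Λ) t B⁆‖ ≤ 2 * ‖A‖ * ‖B‖ *
      ((Real.exp (μ * velocity G F Φ μ * |t|) - 1) / (convConst G F μ).toReal *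
        ((phiBoundary Φ X).card *
          ((decayNorm G F).toReal * Real.exp (-μ * setDist G X Y)))) := by
  have := nonempty_of_setDist_pos hXY
  have hC := convConst_toReal_pos hF hμ.le
  have hd := disjoint_of_setDist_pos hXY
  rw [hamiltonian_eq_sum, mul_velocity hμ]
  refine (norm_lie_heisenberg_sum_le (isSelfAdjoint_localTerm hΦ) commute_localTerm
    (fun x y => (weight_pos hF μ x y).le) ENNReal.toReal_nonneg hC
    (sum_norm_localTerm_le hF hΦμ) (sum_weight_mul_weight_le hF hμ.le Λ)
    (commute_localTerm_of_supportedOn hA) (commute_localTerm_of_supportedOn hB) hd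
    (hA.commute hB hd) (fun Z _ hZ h => exists_mem_phiBoundary X hZ
      (ne_zero_of_localTerm_ne_zero h)) t).trans ?_
  refine mul_le_mul_of_nonneg_left (mul_le_mul_of_nonneg_left
    (sum_sum_weight_le hF hμ.le (phiBoundary_subset X)) ?_) (by positivity)
  exact div_nonneg (sub_nonneg.2 (Real.one_le_exp (by positivity))) hC.le

/-- Lieb–Robinson bound with the smaller of the two boundaries. -/
theorem norm_lie_heisenberg_hamiltonian_le {G : SimpleGraph Γ} {F : ℝ → ℝ}
    (hΦ : ∀ Z, (Φ Z).IsHermitian) (hF : IsDecayFunction G F) {X Y : Finset Γ} {hX : X ⊆ Λ}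
    {hY : Y ⊆ Λ} (hXY : 0 < setDist G X Y) {A B : Op S Λ} (hA : SupportedOn hX A)
    (hB : SupportedOn hY B) {μ : ℝ} (hμ : 0 < μ) (hΦμ : interactionNorm G F Φ μ < ⊤) (t : ℝ) :
    ‖⁅A, heisenberg (hamiltonian Φ Λ) t B⁆‖ ≤ 2 * ‖A‖ * ‖B‖ *
      ((Real.exp (μ * velocity G F Φ μ * |t|) - 1) / (convConst G F μ).toReal *
        ((min (phiBoundary Φ X).card (phiBoundary Φ Y).card : ℕ) *
          ((decayNorm G F).toReal * Real.exp (-μ * setDist G X Y)))) := by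
  rcases min_choice (phiBoundary Φ X).card (phiBoundary Φ Y).card with h | h
  · rw [h]
    exact norm_lie_heisenberg_hamiltonian_le_card hΦ hF hXY hA hB hμ hΦμ t
  -- The evolution moves to `A` at time `-t`, so `Y` becomes the support at rest; `|t|` and the
  -- distance are unchanged.
  · rw [h, ← norm_lie_heisenberg_neg (isSelfAdjoint_hamiltonian hΦ), norm_lie_comm,
      mul_right_comm 2 ‖A‖, setDist_comm X Y, ← abs_neg t]
    exact norm_lie_heisenberg_hamiltonian_le_card hΦ hF (by rwa [setDist_comm]) hB hA hμ hΦμ (-t)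

end Interaction

/-! ### Integrating exponentially growing commutators -/

section Perturbation

variable {𝔄 : Type*} [CStarAlgebra 𝔄]

/-- For `c > 0` the `-1` is dropped and `K e^{cs}` has primitive `K/c · e^{cs}`. For `c = 0` the
`-1` makes the commutators vanish, so the dynamics agree on `b`, matching `K / 0 = 0`; this is the
reading of `c₁` as `0` when `v_μ = 0`. -/
theorem norm_heisenberg_sub_heisenberg_le_exp_of_nonneg {H H₁ : 𝔄} (hH₁ : IsSelfAdjoint H₁)
    (b : 𝔄) {K c : ℝ} (hK : 0 ≤ K) (hc : 0 ≤ c)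
    (h : ∀ s, 0 ≤ s → ‖⁅H - H₁, heisenberg H s b⁆‖ ≤ K * (Real.exp (c * s) - 1))
    {t : ℝ} (ht : 0 ≤ t) :
    ‖heisenberg H t b - heisenberg H₁ t b‖ ≤ K / c * Real.exp (c * t) := by
  rcases hc.eq_or_lt with rfl | hc
  · simpa using norm_heisenberg_sub_heisenberg_le hH₁ b ht (g := fun _ => 0) (g' := fun _ => 0)
      (fun s => hasDerivAt_const s 0) le_rfl (fun s hs => by simpa using h s hs)
  · refine norm_heisenberg_sub_heisenberg_le hH₁ b ht (g := fun s => K / c * Real.exp (c * s))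
      (g' := fun s => K * Real.exp (c * s)) (fun s => ?_) (by positivity) (fun s hs => ?_)
    · have := (((hasDerivAt_id s).const_mul c).exp).const_mul (K / c)
      convert! this using 1
      simp only [id]
      field_simp
    · exact (h s hs).trans (mul_le_mul_of_nonneg_left (sub_le_self _ zero_le_one) hK)

/-- Exponentially growing commutators control the difference of two dynamics. -/
theorem norm_heisenberg_sub_heisenberg_le_exp {H H₁ : 𝔄} (hH₁ : IsSelfAdjoint H₁)
    (b : 𝔄) {K c : ℝ} (hK : 0 ≤ K) (hc : 0 ≤ c)
    (h : ∀ s, ‖⁅H - H₁, heisenberg H s b⁆‖ ≤ K * (Real.exp (c * |s|) - 1)) (t : ℝ) :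
    ‖heisenberg H t b - heisenberg H₁ t b‖ ≤ K / c * Real.exp (c * |t|) := by
  rcases le_total 0 t with ht | ht
  · rw [abs_of_nonneg ht]
    exact norm_heisenberg_sub_heisenberg_le_exp_of_nonneg hH₁ b hK hc
      (fun s hs => by simpa only [abs_of_nonneg hs] using h s) ht
  · rw [abs_of_nonpos ht]
    have := norm_heisenberg_sub_heisenberg_le_exp_of_nonneg (H := -H) hH₁.neg b hK hc
      (fun s hs => ?_) (neg_nonneg.2 ht)
    · rwa [heisenberg_neg, heisenberg_neg, neg_neg] at this
    · have hs' := h (-s)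
      rw [abs_neg, abs_of_nonneg hs] at hs'
      rwa [heisenberg_neg, ← neg_sub', norm_neg_lie]

end Perturbation

end SpinLattice

/-! ### The two quench bounds -/

theorem lemma1 {Γ : Type*} [DecidableEq Γ] (G : SimpleGraph Γ) (hG : G.Connected)
    {S : Γ → Type*} [∀ i, Fintype (S i)] [∀ i, DecidableEq (S i)]
    (Φ : (Z : Finset Γ) → Op S Z) (hΦ : ∀ Z, (Φ Z).IsHermitian)
    (F : ℝ → ℝ) (hF : IsDecayFunction G F)
    (Λ X Y : Finset Γ) (hX : X ⊆ Λ) (hY : Y ⊆ Λ) (hXY : 0 < setDist G X Y)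
    (W : Op S Λ) (hW : W.IsHermitian) (hWX : SupportedOn hX W)
    (U : Op S Λ) (hU : U ∈ Matrix.unitaryGroup (Cfg S Λ) ℂ) (hUX : SupportedOn hX U)
    (ψ : Hilb S Λ) (hψ : ‖ψ‖ = 1)
    (μ : ℝ) (hμ : 0 < μ) (hΦμ : interactionNorm G F Φ μ < ⊤) (t : ℝ) :
    -- quench of the Hamiltonian
    traceNorm
        (reducedState Y (evolve (hamiltonian Φ Λ) t ψ)
          - reducedState Y (evolve (hamiltonian Φ Λ + W) t ψ))
      ≤ 2 * ‖W‖ * (decayNorm G F).toReal / (μ * velocity G F Φ μ * (convConst G F μ).toReal)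
          * (min (phiBoundary Φ X).card (phiBoundary Φ Y).card : ℕ)
          * Real.exp (-μ * ((setDist G X Y : ℝ) - velocity G F Φ μ * |t|)) ∧
    -- quench of the initial state
    traceNorm
        (reducedState Y (evolve (hamiltonian Φ Λ) t ψ)
          - reducedState Y (evolve (hamiltonian Φ Λ) t (Matrix.toEuclideanLin U ψ)))
      ≤ 2 * (decayNorm G F).toReal / (convConst G F μ).toReal
          * (min (phiBoundary Φ X).card (phiBoundary Φ Y).card : ℕ)
          * Real.exp (-μ * ((setDist G X Y : ℝ) - velocity G F Φ μ * |t|)) := by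
  have hv : 0 ≤ velocity G F Φ μ := velocity_nonneg hμ
  have hH : IsSelfAdjoint (hamiltonian Φ Λ) := isSelfAdjoint_hamiltonian hΦ
  have hW' : IsSelfAdjoint W := hW
  have hexp : Real.exp (-μ * ((setDist G X Y : ℝ) - velocity G F Φ μ * |t|))
      = Real.exp (-μ * setDist G X Y) * Real.exp (μ * velocity G F Φ μ * |t|) := by
    rw [← Real.exp_add]
    ring_nf
  have hlr := fun (A : Op S Λ) (hA : SupportedOn hX A) (B : Op S Y) (s : ℝ) =>
    norm_lie_heisenberg_hamiltonian_le hΦ hF hXY hA (hB := ⟨B, rfl⟩) (hY := hY) hμ hΦμ s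
  have hnB : ∀ B : Op S Y, ‖B‖ = 1 → ‖embed hY B‖ ≤ 1 := fun B hB => hB ▸ norm_embed_le hY B
  have h1 : ∀ s : ℝ, 0 ≤ Real.exp (μ * velocity G F Φ μ * |s|) - 1 := fun s =>
    sub_nonneg.2 (Real.one_le_exp (by positivity))
  rw [hexp]
  set m := min (phiBoundary Φ X).card (phiBoundary Φ Y).card
  set f := (decayNorm G F).toReal
  set C := (convConst G F μ).toReal
  have hf : 0 ≤ f := ENNReal.toReal_nonneg
  have hC : 0 ≤ C := ENNReal.toReal_nonneg
  set e := Real.exp (-μ * setDist G X Y)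
  have he : 0 < e := Real.exp_pos _
  constructor
  · refine traceNorm_reducedState_evolve_sub_le hY hH (hH.add hW') hψ t (by positivity)
      fun B hB => ?_
    -- `K` collects the time-independent factors of the Lieb–Robinson bound with `‖B‖ = 1`; division
    -- by the growth rate `μ v_μ` produces the denominator of `c₁`.
    refine (norm_heisenberg_sub_heisenberg_le_exp (K := 2 * ‖W‖ * (m * (f * e) / C))
      (c := μ * velocity G F Φ μ) (hH.add hW') _ (by positivity) (by positivity)
      (fun s => ?_) t).trans_eq ?_
    · rw [sub_add_cancel_left, norm_neg_lie]
      have := h1 s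
      calc _ ≤ _ := hlr W hWX B s
        _ ≤ 2 * ‖W‖ * 1 * _ := by
            gcongr
            exact hnB B hB
        _ = _ := by ring
    · simp only [div_eq_mul_inv, mul_inv]
      ring
  · refine traceNorm_reducedState_evolve_unitary_sub_le hY hH hU hψ t (by positivity)
      fun B hB => ?_
    have := h1 t
    have hUn : ‖U‖ ≤ 1 := by
      rcases subsingleton_or_nontrivial (Op S Λ) with _ | _
      · rw [Subsingleton.elim U 0, norm_zero]
        exact zero_le_one
      · exact (CStarRing.norm_of_mem_unitary hU).le
    calc _ ≤ _ := hlr U hUX B t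
      _ ≤ 2 * 1 * 1 * (Real.exp (μ * velocity G F Φ μ * |t|) / C * (m * (f * e))) := by
          gcongr
          · exact hnB B hB
          · exact sub_le_self _ zero_le_one
      _ = _ := by ring
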